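/- Let $G_1$ and $G_2$ be finite simple undirected graphs with adjacency matrices $A_1,A_2$ (entries in $\{0,1\}$), and suppose that they are isospectral, i.e. $A_1$ and $A_2$ have the same eigenvalues counted with multiplicity; let $M$ be the common number of vertices. Let $c>0$ satisfy $c\,\|A_1\|_2<1$, where $\|\cdot\|_2$ is the spectral norm (equivalently $c\,\|A_2\|_2<1$). For $G\in\{G_1,G_2\}$ with adjacency matrix $A$ put $$C_G=c\,(A\oplus A)\in\mathbb{R}^{2M\times 2M},\qquad X=\begin{bmatrix}0&\mathbb{I}_M\\ \mathbb{I}_M&0\end{bmatrix},\qquad \sigma_{Q,G}=(\mathbb{I}_{2M}-XC_G)^{-1},$$ and for every photon pattern $\boldsymbol n=(n_1,\dots,n_M)\in\mathbb{Z}_{\ge0}^M$ let $$p_G(\boldsymbol n)=\frac{1}{n_1!\cdots n_M!\,\sqrt{\det\sigma_{Q,G}}}\;\prod_{i=1}^M\frac{\partial^{n_i}}{\partial\beta_i^{n_i}}\frac{\partial^{n_i}}{\partial\bar\beta_i^{n_i}}\;e^{\frac12\boldsymbol\gamma^\top C_G\boldsymbol\gamma}\Big|_{\boldsymbol\gamma=0},\qquad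 \boldsymbol\gamma=(\beta_1,\dots,\beta_M,\bar\beta_1,\dots,\bar\beta_M),$$ where $\beta_i,\bar\beta_i$ are treated as $2M$ independent variables. This is the probability of detecting the pattern $\boldsymbol n$ in the Gaussian boson sampling device encoding $G$. For $N\in\mathbb{Z}_{\ge0}$ let $$p_G(N)=\sum_{\boldsymbol n\in\mathbb{Z}_{\ge0}^M,\; n_1+\dots+n_M=N}p_G(\boldsymbol n)$$ be the coarse-grained probability of total photon number $N$. Then $$p_{G_1}(N)=p_{G_2}(N)\qquad\text{for all } N\in\mathbb{Z}_{\ge0}.$$ -/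

import Mathlib

open scoped Matrix Nat

noncomputable section

namespace GBS

/-- The matrix `X = [[0, 1], [1, 0]]` exchanging the two halves of `V ⊕ V`. -/
def swapMatrix (V : Type*) [DecidableEq V] : Matrix (V ⊕ V) (V ⊕ V) ℝ :=
  Matrix.fromBlocks 0 1 1 0

/-- The matrix `σ_Q = (1 - X C)⁻¹`. -/
def sigmaQ {V : Type*} [Fintype V] [DecidableEq V] (C : Matrix (V ⊕ V) (V ⊕ V) ℝ) :
    Matrix (V ⊕ V) (V ⊕ V) ℝ :=
  (1 - swapMatrix V * C)⁻¹

/-- The partial derivative `∂f/∂x_i` of a function of the real variables `(x_i)`. -/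
def partialDeriv {ι : Type*} [DecidableEq ι] (i : ι) (f : (ι → ℝ) → ℝ) : (ι → ℝ) → ℝ :=
  fun x => lineDeriv ℝ f x (Pi.single i 1)

/-- The mixed partial derivative `∏ i, ∂_i ^ (m i)` of `f`. The variables are taken in some order
(an enumeration of the finite type `ι`), which is immaterial for smooth `f`. -/
def mixedPartial {ι : Type*} [Fintype ι] [DecidableEq ι] (m : ι → ℕ) (f : (ι → ℝ) → ℝ) :
    (ι → ℝ) → ℝ :=
  (Finset.univ : Finset ι).toList.foldr (fun i g => (partialDeriv i)^[m i] g) f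

/-- The probability of the detection event `n` for the matrix `C`, whose rows and columns are
indexed by the variables `γ = (β, β̄)`: the left copy of `V` carries the variables `β_i`, the right
copy the (independent) variables `β̄_i`, and
`p(n) = (n! √(det σ_Q))⁻¹ ∏ i, ∂_{β_i}^{n_i} ∂_{β̄_i}^{n_i} exp (γᵀ C γ / 2)` at `γ = 0`. -/
def detectionProb {V : Type*} [Fintype V] [DecidableEq V] (C : Matrix (V ⊕ V) (V ⊕ V) ℝ)
    (n : V → ℕ) : ℝ :=
  1 / (((∏ i, (n i)! : ℕ) : ℝ) * √(sigmaQ C).det) *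
    mixedPartial (Sum.elim n n) (fun γ => Real.exp (1 / 2 * (γ ⬝ᵥ (C *ᵥ γ)))) 0

/-- The matrix `C = c (A ⊕ A)` encoding the graph `G` with adjacency matrix `A`. -/
def encoding {V : Type*} [DecidableEq V] (G : SimpleGraph V) [DecidableRel G.Adj] (c : ℝ) :
    Matrix (V ⊕ V) (V ⊕ V) ℝ :=
  c • Matrix.fromBlocks (G.adjMatrix ℝ) 0 0 (G.adjMatrix ℝ)

/-- The coarse-grained probability `p_G(N)`: the sum of `p(n)` over all detection events
`n : V → ℕ` with total photon number `∑ i, n i = N`. -/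
def coarseProb {V : Type*} [Fintype V] [DecidableEq V] (G : SimpleGraph V) [DecidableRel G.Adj]
    (c : ℝ) (N : ℕ) : ℝ :=
  ∑ n ∈ Finset.piAntidiag (Finset.univ : Finset V) N, detectionProb (encoding G c) n

/-- Two graphs are isospectral if their adjacency matrices have the same eigenvalues, counted with
multiplicity (all of them are real). -/
def Isospectral {V W : Type*} [Fintype V] [DecidableEq V] [Fintype W] [DecidableEq W]
    (G : SimpleGraph V) [DecidableRel G.Adj] (H : SimpleGraph W) [DecidableRel H.Adj] : Prop :=
  (G.adjMatrix ℝ).charpoly.roots = (H.adjMatrix ℝ).charpoly.roots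

/-- The spectral norm `‖A‖₂` of the adjacency matrix of `G`. -/
def spectralNorm {V : Type*} [Fintype V] [DecidableEq V] (G : SimpleGraph V)
    [DecidableRel G.Adj] : ℝ :=
  ‖Matrix.toEuclideanCLM (n := V) (𝕜 := ℝ) (G.adjMatrix ℝ)‖

end GBS

end

/-!
By the multinomial theorem in the commutative algebra of constant-coefficient differential
operators, the sum over all `n` with `∑ i, n i = N` of `∏ i, ∂_{β_i}^{n_i} ∂_{β̄_i}^{n_i} / n_i!`
is `D ^ N / N!`, where `D = ∑ i, ∂_{β_i} ∂_{β̄_i}`. For an orthogonal matrix `O` both `D` and the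
matrix `X` are invariant under the simultaneous rotation `O ⊕ O` of `β` and `β̄`. Isospectral
symmetric matrices are orthogonally conjugate, `A = O B Oᵀ`, so this rotation carries
`exp (γᵀ C_B γ / 2)` to `exp (γᵀ C_A γ / 2)` and conjugates `1 - X C_B` to `1 - X C_A`.
-/

noncomputable section

namespace GBS

open scoped ContDiff IsMulCommutative

section DifferentialOperators

variable {E F : Type*} [NormedAddCommGroup E] [NormedSpace ℝ E]
  [NormedAddCommGroup F] [NormedSpace ℝ F]

variable (E) in
/-- The vector space of smooth real-valued functions on `E`, on which the directional derivatives
act as commuting endomorphisms. -/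
def smoothFunctions : Submodule ℝ (E → ℝ) where
  carrier := {f | ContDiff ℝ ∞ f}
  add_mem' := by
    simp only [Set.mem_ofPred_eq]
    exact ContDiff.add
  zero_mem' := by
    rw [Set.mem_ofPred_eq]
    exact contDiff_zero_fun
  smul_mem' c f hf := by
    rw [Set.mem_ofPred_eq] at hf ⊢
    exact hf.const_smul c

lemma contDiff_coe (f : smoothFunctions E) : ContDiff ℝ ∞ f.1 := f.2

lemma differentiable_coe (f : smoothFunctions E) : Differentiable ℝ f.1 :=
  (contDiff_coe f).differentiable (by simp)

lemma contDiff_fderiv_coe (f : smoothFunctions E) : ContDiff ℝ ∞ (fderiv ℝ f.1) :=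
  (contDiff_coe f).fderiv_right (by simp)

/-- The directional derivative `f ↦ ∂_v f` as an operator on smooth functions, linear in the
direction `v`. -/
def dirDeriv : E →ₗ[ℝ] Module.End ℝ (smoothFunctions E) :=
  LinearMap.mk₂ ℝ
    (fun v f => ⟨fun x => fderiv ℝ f.1 x v, (contDiff_fderiv_coe f).clm_apply contDiff_const⟩)
    (fun v w f => by ext x; simp)
    (fun a v f => by ext x; simp)
    (fun v f g => by ext x; simp [fderiv_add (differentiable_coe f x) (differentiable_coe g x)])
    (fun a v f => by ext x; simp [fderiv_const_smul (differentiable_coe f x)])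

lemma dirDeriv_dirDeriv_apply (v w : E) (f : smoothFunctions E) (x : E) :
    (dirDeriv v (dirDeriv w f)).1 x = fderiv ℝ (fderiv ℝ f.1) x v w := by
  have hf : DifferentiableAt ℝ (fderiv ℝ f.1) x :=
    (contDiff_fderiv_coe f).differentiable (by simp) x
  change fderiv ℝ (fun y => fderiv ℝ f.1 y w) x v = _
  simp [fderiv_clm_apply hf (differentiableAt_const w)]

lemma commute_dirDeriv (v w : E) : Commute (dirDeriv v) (dirDeriv w) := by
  ext f x
  simp only [Module.End.mul_apply, dirDeriv_dirDeriv_apply]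
  have htwo : minSmoothness ℝ 2 ≤ (∞ : WithTop ℕ∞) := by
    rw [minSmoothness_of_isRCLikeNormedField]
    exact ENat.LEInfty.out
  exact ((contDiff_coe f).contDiffAt.isSymmSndFDerivAt htwo).eq v w

variable (E) in
/-- The algebra of constant-coefficient differential operators acting on smooth functions. It is
commutative, so that multi-index identities can be proved by computing in a commutative ring. -/
abbrev diffOps : Subalgebra ℝ (Module.End ℝ (smoothFunctions E)) :=
  Algebra.adjoin ℝ (Set.range dirDeriv)

instance : IsMulCommutative (diffOps E) :=
  Algebra.isMulCommutative_adjoin ℝ <| by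
    rintro _ ⟨v, rfl⟩ _ ⟨w, rfl⟩
    exact commute_dirDeriv v w

/-- The directional derivative `∂_v` as an element of the commutative algebra `diffOps E`. -/
def dirOp : E →ₗ[ℝ] diffOps E :=
  dirDeriv.codRestrict (Subalgebra.toSubmodule (diffOps E)) fun v =>
    Algebra.subset_adjoin (Set.mem_range_self v)

/-- Composition of smooth functions with a continuous linear map `T`. -/
def pullback (T : E →L[ℝ] F) : smoothFunctions F →ₗ[ℝ] smoothFunctions E where
  toFun f := ⟨f.1 ∘ T, (contDiff_coe f).comp T.contDiff⟩
  map_add' _ _ := rfl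
  map_smul' _ _ := rfl

lemma pullback_apply (T : E →L[ℝ] F) (f : smoothFunctions F) (x : E) :
    (pullback T f).1 x = f.1 (T x) := rfl

lemma dirOp_smul_pullback (T : E →L[ℝ] F) (v : E) (f : smoothFunctions F) :
    dirOp v • pullback T f = pullback T (dirOp (T v) • f) := by
  ext x
  have hcomp : fderiv ℝ (f ∘ T) x = (fderiv ℝ f.1 (T x)).comp T := by
    rw [fderiv_comp x (differentiable_coe f _) T.differentiableAt, T.fderiv]
  exact congrArg (· v) hcomp

end DifferentialOperators

section Coordinates

variable {ι : Type*} [Fintype ι] [DecidableEq ι]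

/-- The partial derivative `∂_i` with respect to the `i`-th coordinate, as an element of the
commutative algebra of differential operators. -/
def coordOp (i : ι) : diffOps (ι → ℝ) := dirOp (Pi.single i 1)

lemma dirOp_eq_sum_coordOp (v : ι → ℝ) : dirOp v = ∑ i, v i • coordOp i := by
  conv_lhs => rw [pi_eq_sum_univ' v, map_sum]
  simp only [map_smul]
  rfl

lemma coe_coordOp_smul (i : ι) (f : smoothFunctions (ι → ℝ)) :
    ((coordOp i • f : smoothFunctions (ι → ℝ)) : (ι → ℝ) → ℝ) = partialDeriv i f := by
  ext x
  exact (differentiable_coe f x).lineDeriv_eq_fderiv.symm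

lemma coe_coordOp_pow_smul (i : ι) (k : ℕ) (f : smoothFunctions (ι → ℝ)) :
    ((coordOp i ^ k • f : smoothFunctions (ι → ℝ)) : (ι → ℝ) → ℝ) = (partialDeriv i)^[k] f := by
  induction k with
  | zero => rw [pow_zero, one_smul, Function.iterate_zero_apply]
  | succ k ih => rw [pow_succ', mul_smul, coe_coordOp_smul, ih, Function.iterate_succ_apply']

lemma mixedPartial_coe (m : ι → ℕ) (f : smoothFunctions (ι → ℝ)) :
    mixedPartial m f = ((∏ i, coordOp i ^ m i) • f : smoothFunctions (ι → ℝ)) := by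
  rw [mixedPartial, ← Finset.prod_map_toList]
  induction (Finset.univ : Finset ι).toList with
  | nil => simp
  | cons i l ih =>
    rw [List.foldr_cons, ih, List.map_cons, List.prod_cons, mul_smul, coe_coordOp_pow_smul]

end Coordinates

section PairOperator

variable {V : Type*} [Fintype V] [DecidableEq V]

variable (V) in
/-- The operator `∑ v, ∂_{β_v} ∂_{β̄_v}` on functions of the variables `γ = (β, β̄)`; its `N`-th
power collects the mixed derivatives of all detection events with `N` photons. -/
def pairOp : diffOps (V ⊕ V → ℝ) := ∑ v, coordOp (Sum.inl v) * coordOp (Sum.inr v)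

lemma pairOp_pow (N : ℕ) :
    pairOp V ^ N = ∑ n ∈ Finset.piAntidiag (Finset.univ : Finset V) N,
      (Nat.multinomial Finset.univ n : ℝ) • ∏ i, coordOp i ^ Sum.elim n n i := by
  rw [pairOp, Finset.sum_pow_eq_sum_piAntidiag]
  refine Finset.sum_congr rfl fun n _ => ?_
  simp only [mul_pow, Finset.prod_mul_distrib, Fintype.prod_sum_type, Sum.elim_inl, Sum.elim_inr,
    Nat.cast_smul_eq_nsmul, nsmul_eq_mul]

lemma sum_mixedPartial_div_factorial (f : smoothFunctions (V ⊕ V → ℝ)) (N : ℕ) (γ : V ⊕ V → ℝ) :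
    ∑ n ∈ Finset.piAntidiag (Finset.univ : Finset V) N,
        mixedPartial (Sum.elim n n) f γ / (∏ v, (n v)! : ℕ) =
      (pairOp V ^ N • f).1 γ / N ! := by
  have hpow : (pairOp V ^ N • f).1 γ = ∑ n ∈ Finset.piAntidiag (Finset.univ : Finset V) N,
      (Nat.multinomial Finset.univ n : ℝ) * mixedPartial (Sum.elim n n) f γ := by
    rw [pairOp_pow, Finset.sum_smul, Submodule.coe_sum, Finset.sum_apply]
    refine Finset.sum_congr rfl fun n _ => ?_
    rw [mixedPartial_coe]
    rfl
  rw [hpow, Finset.sum_div]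
  refine Finset.sum_congr rfl fun n hn => ?_
  have hN : (N ! : ℝ) = (∏ v, (n v)! : ℕ) * Nat.multinomial Finset.univ n := by
    rw [← (Finset.mem_piAntidiag.1 hn).1, ← Nat.multinomial_spec, Nat.cast_mul]
  have hmultinomial : (Nat.multinomial Finset.univ n : ℝ) ≠ 0 :=
    Nat.cast_ne_zero.2 (Nat.multinomial_pos _ _).ne'
  rw [hN, mul_comm _ (Nat.multinomial _ _ : ℝ), mul_div_mul_left _ _ hmultinomial]

end PairOperator

section ModeTransformation

variable {U V W R : Type*}

lemma sum_smul_mul_sum_smul_of_transpose_mul_self {S : Type*} [Fintype V] [Fintype W]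
    [DecidableEq W] [CommSemiring R] [Semiring S] [Algebra R S] {O : Matrix V W R}
    (hO : Oᵀ * O = 1) (a b : W → S) :
    ∑ v, (∑ w, O v w • a w) * ∑ w, O v w • b w = ∑ w, a w * b w := by
  have horth (w w' : W) : ∑ v, O v w * O v w' = if w = w' then 1 else 0 := by
    simpa only [Matrix.mul_apply, Matrix.transpose_apply, Matrix.one_apply] using
      congrFun (congrFun hO w) w'
  calc ∑ v, (∑ w, O v w • a w) * ∑ w, O v w • b w
      = ∑ v, ∑ w, ∑ w', (O v w * O v w') • (a w * b w') := by
        simp only [Finset.sum_mul_sum, smul_mul_smul_comm]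
    _ = ∑ w, ∑ w', (∑ v, O v w * O v w') • (a w * b w') := by
        rw [Finset.sum_comm]
        simp only [Finset.sum_smul]
        exact Finset.sum_congr rfl fun w _ => Finset.sum_comm
    _ = ∑ w, a w * b w := by
        simp only [horth, ite_smul, one_smul, zero_smul, Finset.sum_ite_eq, Finset.mem_univ,
          if_true]

/-- The matrix `O ⊕ O`, through which a transformation `O` of the modes acts on the variables
`γ = (β, β̄)`. -/
def doubled [Zero R] (O : Matrix V W R) : Matrix (V ⊕ V) (W ⊕ W) R :=
  Matrix.fromBlocks O 0 0 O

lemma doubled_transpose [Zero R] (O : Matrix V W R) : (doubled O)ᵀ = doubled Oᵀ := by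
  simp [doubled, Matrix.fromBlocks_transpose]

lemma doubled_one [DecidableEq W] [Zero R] [One R] : doubled (1 : Matrix W W R) = 1 :=
  Matrix.fromBlocks_one

variable [Fintype W]

lemma doubled_mul [NonUnitalNonAssocSemiring R] (O : Matrix V W R) (B : Matrix W U R) :
    doubled (O * B) = doubled O * doubled B := by
  simp [doubled, Matrix.fromBlocks_multiply]

variable [Fintype V] [DecidableEq V] [DecidableEq W]

lemma swapMatrix_mul_doubled (O : Matrix V W ℝ) :
    swapMatrix V * doubled O = doubled O * swapMatrix W := by
  simp [swapMatrix, doubled, Matrix.fromBlocks_multiply]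

lemma det_one_sub_swapMatrix_mul_conj {O : Matrix V W ℝ} (hO : Oᵀ * O = 1)
    (C : Matrix (W ⊕ W) (W ⊕ W) ℝ) :
    (1 - swapMatrix V * (doubled O * C * (doubled O)ᵀ)).det = (1 - swapMatrix W * C).det := by
  have hP : (doubled O)ᵀ * doubled O = 1 := by
    rw [doubled_transpose, ← doubled_mul, hO, doubled_one]
  rw [← Matrix.mul_assoc, ← Matrix.mul_assoc, swapMatrix_mul_doubled, Matrix.mul_assoc (doubled O),
    Matrix.mul_assoc (doubled O), Matrix.det_one_sub_mul_comm, Matrix.mul_assoc, hP, Matrix.mul_one]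

/-- The linear substitution `γ ↦ Pᵀ γ`. -/
def transposeCLM {ι κ : Type*} [Fintype ι] [Fintype κ] (P : Matrix ι κ ℝ) :
    (ι → ℝ) →L[ℝ] (κ → ℝ) :=
  LinearMap.toContinuousLinearMap Pᵀ.mulVecLin

lemma transposeCLM_apply {ι κ : Type*} [Fintype ι] [Fintype κ] (P : Matrix ι κ ℝ) (γ : ι → ℝ) :
    transposeCLM P γ = Pᵀ *ᵥ γ := rfl

lemma coordOp_smul_pullback {ι κ : Type*} [Fintype ι] [DecidableEq ι] [Fintype κ] [DecidableEq κ]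
    (P : Matrix ι κ ℝ) (i : ι) (f : smoothFunctions (κ → ℝ)) :
    coordOp i • pullback (transposeCLM P) f =
      pullback (transposeCLM P) ((∑ k, P i k • coordOp k) • f) := by
  rw [coordOp, dirOp_smul_pullback, transposeCLM_apply, Matrix.mulVec_single_one,
    dirOp_eq_sum_coordOp]
  rfl

lemma pairOp_smul_pullback {O : Matrix V W ℝ} (hO : Oᵀ * O = 1)
    (f : smoothFunctions (W ⊕ W → ℝ)) :
    pairOp V • pullback (transposeCLM (doubled O)) f =
      pullback (transposeCLM (doubled O)) (pairOp W • f) := by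
  have hpair : ∑ v, (∑ k, doubled O (Sum.inl v) k • coordOp k) *
      ∑ k, doubled O (Sum.inr v) k • coordOp k = pairOp W := by
    simp only [doubled, Fintype.sum_sum_type, Matrix.fromBlocks_apply₁₁, Matrix.fromBlocks_apply₁₂,
      Matrix.fromBlocks_apply₂₁, Matrix.fromBlocks_apply₂₂, Matrix.zero_apply, zero_smul,
      Finset.sum_const_zero, add_zero, zero_add]
    rw [sum_smul_mul_sum_smul_of_transpose_mul_self hO, pairOp]
  rw [← hpair, pairOp, Finset.sum_smul, Finset.sum_smul, map_sum]
  refine Finset.sum_congr rfl fun v _ => ?_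
  rw [mul_smul, coordOp_smul_pullback, coordOp_smul_pullback, ← mul_smul]

lemma pairOp_pow_smul_pullback {O : Matrix V W ℝ} (hO : Oᵀ * O = 1) (N : ℕ)
    (f : smoothFunctions (W ⊕ W → ℝ)) :
    pairOp V ^ N • pullback (transposeCLM (doubled O)) f =
      pullback (transposeCLM (doubled O)) (pairOp W ^ N • f) := by
  induction N with
  | zero => simp only [pow_zero, one_smul]
  | succ N ih => rw [pow_succ', mul_smul, ih, pairOp_smul_pullback hO, ← mul_smul, ← pow_succ']

end ModeTransformation

section GaussianGenerating

variable {ι κ : Type*} [Fintype ι] [Fintype κ]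

/-- The generating function `γ ↦ exp (γᵀ C γ / 2)` of the detection probabilities. -/
def gaussian (C : Matrix ι ι ℝ) : smoothFunctions (ι → ℝ) :=
  ⟨fun γ => Real.exp (1 / 2 * (γ ⬝ᵥ (C *ᵥ γ))), by
    change ContDiff ℝ ∞ _
    unfold dotProduct Matrix.mulVec dotProduct
    fun_prop⟩

lemma gaussian_conj (P : Matrix ι κ ℝ) (C : Matrix κ κ ℝ) :
    gaussian (P * C * Pᵀ) = pullback (transposeCLM P) (gaussian C) := by
  ext γ
  change Real.exp (1 / 2 * (γ ⬝ᵥ ((P * C * Pᵀ) *ᵥ γ))) =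
    Real.exp (1 / 2 * ((Pᵀ *ᵥ γ) ⬝ᵥ (C *ᵥ (Pᵀ *ᵥ γ))))
  rw [← Matrix.mulVec_mulVec, ← Matrix.mulVec_mulVec, Matrix.dotProduct_mulVec,
    Matrix.mulVec_transpose]

end GaussianGenerating

section CoarseGraining

variable {V W : Type*} [Fintype V] [DecidableEq V] [Fintype W] [DecidableEq W]

/-- The coarse-grained probability of `N` photons without its normalization `1 / √(det σ_Q)`. -/
def coarseWeight (C : Matrix (V ⊕ V) (V ⊕ V) ℝ) (N : ℕ) : ℝ :=
  ∑ n ∈ Finset.piAntidiag (Finset.univ : Finset V) N,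
    mixedPartial (Sum.elim n n) (fun γ => Real.exp (1 / 2 * (γ ⬝ᵥ (C *ᵥ γ)))) 0 /
      (∏ v, (n v)! : ℕ)

lemma sum_detectionProb (C : Matrix (V ⊕ V) (V ⊕ V) ℝ) (N : ℕ) :
    ∑ n ∈ Finset.piAntidiag (Finset.univ : Finset V) N, detectionProb C n =
      coarseWeight C N / √((1 - swapMatrix V * C).det)⁻¹ := by
  simp only [detectionProb, coarseWeight, sigmaQ, Matrix.det_nonsing_inv, Ring.inverse_eq_inv',
    Finset.sum_div, div_div, one_div_mul_eq_div]

lemma coarseWeight_eq (C : Matrix (V ⊕ V) (V ⊕ V) ℝ) (N : ℕ) :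
    coarseWeight C N = (pairOp V ^ N • gaussian C).1 0 / N ! :=
  sum_mixedPartial_div_factorial (gaussian C) N 0

lemma coarseWeight_conj {O : Matrix V W ℝ} (hO : Oᵀ * O = 1) (C : Matrix (W ⊕ W) (W ⊕ W) ℝ)
    (N : ℕ) : coarseWeight (doubled O * C * (doubled O)ᵀ) N = coarseWeight C N := by
  rw [coarseWeight_eq, coarseWeight_eq, gaussian_conj, pairOp_pow_smul_pullback hO, pullback_apply,
    map_zero]

end CoarseGraining

section Isospectral

lemma exists_equiv_comp_eq_of_map_univ_eq {α β γ : Type*} [Fintype α] [Fintype β] {f : α → γ}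
    {g : β → γ} (h : Finset.univ.val.map f = Finset.univ.val.map g) :
    ∃ e : α ≃ β, g ∘ e = f := by
  classical
  have hfiber (c : γ) : Fintype.card {a // f a = c} = Fintype.card {b // g b = c} := by
    have hcount := congrArg (Multiset.count c) h
    simpa only [Multiset.count_map, Fintype.card_subtype, Finset.card_def, Finset.filter_val,
      eq_comm] using hcount
  exact ⟨.ofFiberEquiv fun c => Fintype.equivOfCardEq (hfiber c),
    funext (Equiv.ofFiberEquiv_map _)⟩

variable {V W : Type*} [Fintype V] [DecidableEq V] [Fintype W] [DecidableEq W]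

lemma exists_eq_mul_diagonal_mul_transpose {A : Matrix V V ℝ} (hA : A.IsHermitian) {d : W → ℝ}
    (hd : A.charpoly.roots = Finset.univ.val.map d) :
    ∃ U : Matrix V W ℝ, Uᵀ * U = 1 ∧ A = U * Matrix.diagonal d * Uᵀ := by
  rw [hA.roots_charpoly_eq_eigenvalues] at hd
  obtain ⟨e, he : hA.eigenvalues ∘ e = d⟩ := exists_equiv_comp_eq_of_map_univ_eq hd.symm
  have hU : star (hA.eigenvectorUnitary : Matrix V V ℝ) * hA.eigenvectorUnitary = 1 :=
    Unitary.coe_star_mul_self _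
  have hspectral : A = hA.eigenvectorUnitary * Matrix.diagonal hA.eigenvalues *
      star (hA.eigenvectorUnitary : Matrix V V ℝ) := hA.spectral_theorem
  rw [Matrix.star_eq_conjTranspose, Matrix.conjTranspose_eq_transpose_of_trivial] at hU hspectral
  refine ⟨(hA.eigenvectorUnitary : Matrix V V ℝ).submatrix id e, ?_, ?_⟩
  · rw [Matrix.transpose_submatrix, ← Matrix.submatrix_mul _ _ _ _ _ Function.bijective_id, hU,
      Matrix.submatrix_one_equiv]
  · rw [← he, ← Matrix.submatrix_diagonal_equiv, Matrix.transpose_submatrix,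
      Matrix.submatrix_mul_equiv, Matrix.submatrix_mul_equiv, Matrix.submatrix_id_id]
    exact hspectral

lemma exists_orthogonal_conj_of_roots_charpoly_eq {A : Matrix V V ℝ} {B : Matrix W W ℝ}
    (hA : A.IsHermitian) (hB : B.IsHermitian) (h : A.charpoly.roots = B.charpoly.roots) :
    ∃ O : Matrix V W ℝ, Oᵀ * O = 1 ∧ A = O * B * Oᵀ := by
  have hroots : B.charpoly.roots = Finset.univ.val.map hB.eigenvalues :=
    hB.roots_charpoly_eq_eigenvalues
  obtain ⟨U, hU, hAU⟩ := exists_eq_mul_diagonal_mul_transpose hA (h.trans hroots)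
  obtain ⟨T, hT, hBT⟩ := exists_eq_mul_diagonal_mul_transpose hB hroots
  refine ⟨U * Tᵀ, ?_, ?_⟩
  · calc (U * Tᵀ)ᵀ * (U * Tᵀ) = T * (Uᵀ * U) * Tᵀ := by
          simp only [Matrix.transpose_mul, Matrix.transpose_transpose, Matrix.mul_assoc]
      _ = 1 := by rw [hU, Matrix.mul_one, mul_eq_one_comm.1 hT]
  · calc A = U * (Tᵀ * T) * Matrix.diagonal hB.eigenvalues * (Tᵀ * T) * Uᵀ := by
          rw [hT, Matrix.mul_one, Matrix.mul_one, ← hAU]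
      _ = U * Tᵀ * (T * Matrix.diagonal hB.eigenvalues * Tᵀ) * (U * Tᵀ)ᵀ := by
          simp only [Matrix.transpose_mul, Matrix.transpose_transpose, Matrix.mul_assoc]
      _ = U * Tᵀ * B * (U * Tᵀ)ᵀ := by rw [← hBT]

end Isospectral

end GBS

end

open GBS in
theorem mainTheorem5_general {V W : Type*} [Fintype V] [DecidableEq V] [Fintype W] [DecidableEq W]
    {A : Matrix V V ℝ} {B : Matrix W W ℝ} (hA : A.IsHermitian) (hB : B.IsHermitian)
    (h : A.charpoly.roots = B.charpoly.roots) (c : ℝ) :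
    (1 - swapMatrix V * c • Matrix.fromBlocks A 0 0 A).det =
        (1 - swapMatrix W * c • Matrix.fromBlocks B 0 0 B).det ∧
      ∀ N : ℕ, coarseWeight (c • Matrix.fromBlocks A 0 0 A) N =
        coarseWeight (c • Matrix.fromBlocks B 0 0 B) N := by
  obtain ⟨O, hO, rfl⟩ := exists_orthogonal_conj_of_roots_charpoly_eq hA hB h
  have hconj : c • doubled (O * B * Oᵀ) = doubled O * (c • doubled B) * (doubled O)ᵀ := by
    rw [doubled_mul, doubled_mul, doubled_transpose, Matrix.mul_smul, Matrix.smul_mul]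
  change (1 - _ * c • doubled (O * B * Oᵀ)).det = _ ∧ ∀ N, coarseWeight (c • doubled _) N = _
  rw [hconj]
  exact ⟨det_one_sub_swapMatrix_mul_conj hO _, coarseWeight_conj hO _⟩

theorem mainTheorem5 {V₁ V₂ : Type*} [Fintype V₁] [DecidableEq V₁] [Fintype V₂] [DecidableEq V₂]
    (G₁ : SimpleGraph V₁) [DecidableRel G₁.Adj] (G₂ : SimpleGraph V₂) [DecidableRel G₂.Adj]
    (hspec : GBS.Isospectral G₁ G₂)
    (c : ℝ) (hc : 0 < c) (hc₁ : c * GBS.spectralNorm G₁ < 1) :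
    ∀ N : ℕ, GBS.coarseProb G₁ c N = GBS.coarseProb G₂ c N := by
  obtain ⟨hdet, hweight⟩ := mainTheorem5_general (G₁.isHermitian_adjMatrix (R := ℝ))
    (G₂.isHermitian_adjMatrix (R := ℝ)) hspec c
  simp only [GBS.coarseProb, GBS.encoding, GBS.sum_detectionProb, hdet, hweight, implies_true]
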